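/- Let $X$ be a real or complex Banach space. All operators are bounded linear; $B_E$ is the closed unit ball of a Banach space $E$, and $E$ is canonically embedded in $E^{**}$. For a bounded sequence put $\operatorname{ca}((x_n))=\inf_n\sup\{\|x_k-x_l\|: k,l\ge n\}$. For a bounded set $A\subset E$ let $\omega(A)=\inf\{\sup_{a\in A}\operatorname{dist}(a,K):\emptyset\ne K\subset E\text{ weakly compact}\}$, and let $\gamma(A)$ be the supremum of $|\lim_n\lim_m x^*_m(x_n)-\lim_m\lim_n x^*_m(x_n)|$ over all sequences $(x_n)$ in $A$ and $(x_m^*)$ in $B_{E^*}$ for which these limits exist. For an operator $T:X\to Y$ put $\gamma(T)=\gamma(T(B_X))$, $\omega(T)=\omega(T(B_X))$, $\omega(T^*)=\omega(T^*(B_{Y^*}))$. The Right topology on $X$ is the topology of uniform convergence on weakly compact subsets of $X^*$. Define $$\operatorname{uc}(T)=\sup\Big\{\operatorname{ca}\Big(\Big(\sum_{i=1}^nTx_i\Big)_n\Big):(x_n)\subset X,\ \sup_{x^*\in B_{X^*}}\sum_{n=1}^\infty|x^*(x_n)|\le1\Big\};$$ $\operatorname{cc}(T)$, $\operatorname{wcc}(T)$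 and $\operatorname{wcc}_\omega(T)$ are the suprema of $\operatorname{ca}((Tx_n))$, of $\operatorname{dist}(w^*\text{-}\lim Tx_n,\,Y)$ (limit and distance in $Y^{**}$) and of $\omega(\{Tx_n:n\in\mathbb N\})$, respectively, over all weakly Cauchy sequences $(x_n)$ in $B_X$; and $\operatorname{cc}_\rho(T)$, $\operatorname{Rcc}(T)$ and $\operatorname{Rcc}_\omega(T)$ are the corresponding suprema over all Right-Cauchy sequences $(x_n)$ in $B_X$. For a measure $m(T)\in\{\gamma(T),\ \omega(T),\ \omega(T^*)\}$ and a quantity $\kappa$, write $m\preceq\kappa$ if there is a constant $C>0$ such that $m(T)\le C\,\kappa(T)$ for every Banach space $Y$ and every operator $T:X\to Y$. We say that $X$ has the $m$-version of - $(V)$ if $m\preceq\operatorname{uc}$; - $(RD)$ if $m\preceq\operatorname{Rcc}$, and $(RD)_\omega$ if $m\preceq\operatorname{Rcc}_\omega$; - $(SR)$ if $m\preceq\operatorname{cc}_\rho$; - $(D)$ if $m\preceq\operatorname{wcc}$, and $(D)_\omega$ if $m\preceq\operatorname{wcc}_\omega$; - $(RDP)$ if $m\preceq\operatorname{cc}$.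 **Theorem.** For each of the three choices $m(T)=\gamma(T)$, $m(T)=\omega(T)$, $m(T)=\omega(T^*)$, the following implications hold between the $m$-versions of these properties of $X$: $$\begin{array}{ccccccc} (V)&\Longrightarrow&(RD)&\Longrightarrow&(RD)_\omega&\Longrightarrow&(SR)\\ &&\Downarrow&&\Downarrow&&\Downarrow\\ &&(D)&\Longrightarrow&(D)_\omega&\Longrightarrow&(RDP). \end{array}$$ -/

import Mathlib

open Filter Topology
open scoped NNReal ENNReal

universe w u v

noncomputable section

namespace QuantV

/-! All quantities take values in `[0, ∞]`; on bounded sets, bounded sequences and bounded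
operators they are finite and agree with the usual real-valued ones. -/

section Sequences

variable {E : Type u} [NormedAddCommGroup E]

/-- `ca (x_n) = inf_n sup {‖x_k - x_l‖ : k, l ≥ n}`. -/
def ca (x : ℕ → E) : ℝ≥0∞ :=
  ⨅ n : ℕ, ⨆ k ≥ n, ⨆ l ≥ n, edist (x k) (x l)

/-- The non-symmetrised Hausdorff distance `sup {dist (a, B) : a ∈ A}`. -/
def hausExcess (A B : Set E) : ℝ≥0∞ :=
  ⨆ a ∈ A, Metric.infEDist a B

variable (𝕜 : Type w) [RCLike 𝕜] [NormedSpace 𝕜 E]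

/-- Compactness in the weak topology. -/
def IsWeaklyCompact (K : Set E) : Prop :=
  IsCompact (toWeakSpace 𝕜 E '' K)

/-- Cauchy sequences for the weak topology: `(x^*(x_n))` is Cauchy for every `x^* ∈ E^*`. -/
def IsWeaklyCauchy (x : ℕ → E) : Prop :=
  ∀ f : StrongDual 𝕜 E, CauchySeq (fun n => f (x n))

/-- Cauchy sequences for the Right topology of `E`, that is, the topology of uniform convergence
on the weakly (`σ(E^*, E^**)`) compact subsets of `E^*`. -/
def IsRightCauchy (x : ℕ → E) : Prop :=
  ∀ K : Set (StrongDual 𝕜 E), IsWeaklyCompact 𝕜 K →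
    UniformCauchySeqOn (fun (n : ℕ) (f : StrongDual 𝕜 E) => f (x n)) atTop K

/-- The de Blasi measure of weak non-compactness. -/
def omegaSet (A : Set E) : ℝ≥0∞ :=
  sInf {r | ∃ K : Set E, K.Nonempty ∧ IsWeaklyCompact 𝕜 K ∧ r = hausExcess A K}

/-- The double limit measure of weak non-compactness: the supremum of
`|lim_n lim_m x_m^*(x_n) - lim_m lim_n x_m^*(x_n)|` over the sequences `(x_n)` in `A` and
`(x_m^*)` in the closed dual unit ball for which all these limits exist. -/
def gammaSet (A : Set E) : ℝ≥0∞ :=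
  sSup {r | ∃ (x : ℕ → E) (f : ℕ → StrongDual 𝕜 E) (p q : ℕ → 𝕜) (a b : 𝕜),
    (∀ n, x n ∈ A) ∧ (∀ m, ‖f m‖ ≤ 1) ∧
    (∀ n, Tendsto (fun m => f m (x n)) atTop (𝓝 (p n))) ∧ Tendsto p atTop (𝓝 a) ∧
    (∀ m, Tendsto (fun n => f m (x n)) atTop (𝓝 (q m))) ∧ Tendsto q atTop (𝓝 b) ∧
    r = edist a b}

/-- `z` is the weak* limit in `E^**` of the sequence `(x_n)` of elements of `E ⊆ E^**`. -/
def IsWeakStarLimit (x : ℕ → E) (z : StrongDual 𝕜 (StrongDual 𝕜 E)) : Prop :=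
  Tendsto (fun n => StrongDual.toWeakDual (NormedSpace.inclusionInDoubleDual 𝕜 E (x n))) atTop
    (𝓝 (StrongDual.toWeakDual z))

/-- The norm distance of `z ∈ E^**` to the canonical copy of `E`. -/
def distToSpace (z : StrongDual 𝕜 (StrongDual 𝕜 E)) : ℝ≥0∞ :=
  Metric.infEDist z (Set.range (NormedSpace.inclusionInDoubleDual 𝕜 E))

end Sequences

section Operators

variable {𝕜 : Type w} [RCLike 𝕜]
variable {X : Type u} [NormedAddCommGroup X] [NormedSpace 𝕜 X]
variable {Y : Type v} [NormedAddCommGroup Y] [NormedSpace 𝕜 Y]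

/-- The dual operator `T^* : Y^* → X^*`, `T^* y^* = y^* ∘ T`. -/
def dualOp (T : X →L[𝕜] Y) : StrongDual 𝕜 Y →L[𝕜] StrongDual 𝕜 X :=
  ContinuousLinearMap.precomp 𝕜 T

/-- `γ(T) = γ(T(B_X))`. -/
def gammaOp (T : X →L[𝕜] Y) : ℝ≥0∞ :=
  gammaSet 𝕜 (T '' Metric.closedBall 0 1)

/-- `ω(T) = ω(T(B_X))`. -/
def omegaOp (T : X →L[𝕜] Y) : ℝ≥0∞ :=
  omegaSet 𝕜 (T '' Metric.closedBall 0 1)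

/-- `uc(T)`: the supremum of `ca` of the partial sums of `∑ T x_n` over all sequences `(x_n)` in
`X` with `∑ |x^*(x_n)| ≤ 1` for every `x^*` in the closed dual unit ball. -/
def uc (T : X →L[𝕜] Y) : ℝ≥0∞ :=
  sSup {r | ∃ x : ℕ → X,
    (∀ f : StrongDual 𝕜 X, ‖f‖ ≤ 1 → ∑' n, ‖f (x n)‖ₑ ≤ 1) ∧
    r = ca (fun n => ∑ i ∈ Finset.range (n + 1), T (x i))}

/-- `cc(T)`. -/
def cc (T : X →L[𝕜] Y) : ℝ≥0∞ :=
  sSup {r | ∃ x : ℕ → X, (∀ n, ‖x n‖ ≤ 1) ∧ IsWeaklyCauchy 𝕜 x ∧ r = ca (fun n => T (x n))}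

/-- `cc_ρ(T)`. -/
def ccRho (T : X →L[𝕜] Y) : ℝ≥0∞ :=
  sSup {r | ∃ x : ℕ → X, (∀ n, ‖x n‖ ≤ 1) ∧ IsRightCauchy 𝕜 x ∧ r = ca (fun n => T (x n))}

/-- `wcc(T)`. The weak* limit of `(T x_n)` always exists and is unique. -/
def wcc (T : X →L[𝕜] Y) : ℝ≥0∞ :=
  sSup {r | ∃ (x : ℕ → X) (z : StrongDual 𝕜 (StrongDual 𝕜 Y)),
    (∀ n, ‖x n‖ ≤ 1) ∧ IsWeaklyCauchy 𝕜 x ∧ IsWeakStarLimit 𝕜 (fun n => T (x n)) z ∧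
    r = distToSpace 𝕜 z}

/-- `wcc_ω(T)`. -/
def wccOmega (T : X →L[𝕜] Y) : ℝ≥0∞ :=
  sSup {r | ∃ x : ℕ → X, (∀ n, ‖x n‖ ≤ 1) ∧ IsWeaklyCauchy 𝕜 x ∧
    r = omegaSet 𝕜 (Set.range (fun n => T (x n)))}

/-- `Rcc(T)`. The weak* limit of `(T x_n)` always exists and is unique, and it is also the limit
of `(T x_n)` in the Mackey topology `μ(Y^**, Y^*)`. -/
def rcc (T : X →L[𝕜] Y) : ℝ≥0∞ :=
  sSup {r | ∃ (x : ℕ → X) (z : StrongDual 𝕜 (StrongDual 𝕜 Y)),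
    (∀ n, ‖x n‖ ≤ 1) ∧ IsRightCauchy 𝕜 x ∧ IsWeakStarLimit 𝕜 (fun n => T (x n)) z ∧
    r = distToSpace 𝕜 z}

/-- `Rcc_ω(T)`. -/
def rccOmega (T : X →L[𝕜] Y) : ℝ≥0∞ :=
  sSup {r | ∃ x : ℕ → X, (∀ n, ‖x n‖ ≤ 1) ∧ IsRightCauchy 𝕜 x ∧
    r = omegaSet 𝕜 (Set.range (fun n => T (x n)))}

end Operators

section Properties

variable (𝕜 : Type w) [RCLike 𝕜]
variable (X : Type u) [NormedAddCommGroup X] [NormedSpace 𝕜 X]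

/-- There is `C > 0` with `p(T) ≤ C q(T)` for every Banach space `Y` and every bounded linear
operator `T : X → Y`. -/
def Dominates
    (p q : ∀ (Y : Type v) [NormedAddCommGroup Y] [NormedSpace 𝕜 Y], (X →L[𝕜] Y) → ℝ≥0∞) : Prop :=
  ∃ C : ℝ≥0, 0 < C ∧
    ∀ (Y : Type v) [NormedAddCommGroup Y] [NormedSpace 𝕜 Y] [CompleteSpace Y] (T : X →L[𝕜] Y),
      p Y T ≤ C * q Y T

/-! In the names below, the suffix `q` stands for the estimates of `γ(T)`, `qo` for those of
`ω(T)`, and `qos` for those of `ω(T^*)`. A further `O` marks the use of `wcc_ω`, `Rcc_ω` in place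
of `wcc`, `Rcc`. -/

def Vq : Prop := Dominates.{w, u, v} 𝕜 X (fun _ _ _ T => gammaOp T) (fun _ _ _ T => uc T)
def Vqo : Prop := Dominates.{w, u, v} 𝕜 X (fun _ _ _ T => omegaOp T) (fun _ _ _ T => uc T)
def Vqos : Prop := Dominates.{w, u, v} 𝕜 X (fun _ _ _ T => omegaOp (dualOp T)) (fun _ _ _ T => uc T)

def RDq : Prop := Dominates.{w, u, v} 𝕜 X (fun _ _ _ T => gammaOp T) (fun _ _ _ T => rcc T)
def RDqo : Prop := Dominates.{w, u, v} 𝕜 X (fun _ _ _ T => omegaOp T) (fun _ _ _ T => rcc T)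
def RDqos : Prop :=
  Dominates.{w, u, v} 𝕜 X (fun _ _ _ T => omegaOp (dualOp T)) (fun _ _ _ T => rcc T)

def RDqO : Prop := Dominates.{w, u, v} 𝕜 X (fun _ _ _ T => gammaOp T) (fun _ _ _ T => rccOmega T)
def RDqoO : Prop := Dominates.{w, u, v} 𝕜 X (fun _ _ _ T => omegaOp T) (fun _ _ _ T => rccOmega T)
def RDqosO : Prop :=
  Dominates.{w, u, v} 𝕜 X (fun _ _ _ T => omegaOp (dualOp T)) (fun _ _ _ T => rccOmega T)

def SRq : Prop := Dominates.{w, u, v} 𝕜 X (fun _ _ _ T => gammaOp T) (fun _ _ _ T => ccRho T)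
def SRqo : Prop := Dominates.{w, u, v} 𝕜 X (fun _ _ _ T => omegaOp T) (fun _ _ _ T => ccRho T)
def SRqos : Prop :=
  Dominates.{w, u, v} 𝕜 X (fun _ _ _ T => omegaOp (dualOp T)) (fun _ _ _ T => ccRho T)

def Dq : Prop := Dominates.{w, u, v} 𝕜 X (fun _ _ _ T => gammaOp T) (fun _ _ _ T => wcc T)
def Dqo : Prop := Dominates.{w, u, v} 𝕜 X (fun _ _ _ T => omegaOp T) (fun _ _ _ T => wcc T)
def Dqos : Prop :=
  Dominates.{w, u, v} 𝕜 X (fun _ _ _ T => omegaOp (dualOp T)) (fun _ _ _ T => wcc T)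

def DqO : Prop := Dominates.{w, u, v} 𝕜 X (fun _ _ _ T => gammaOp T) (fun _ _ _ T => wccOmega T)
def DqoO : Prop := Dominates.{w, u, v} 𝕜 X (fun _ _ _ T => omegaOp T) (fun _ _ _ T => wccOmega T)
def DqosO : Prop :=
  Dominates.{w, u, v} 𝕜 X (fun _ _ _ T => omegaOp (dualOp T)) (fun _ _ _ T => wccOmega T)

def RDPq : Prop := Dominates.{w, u, v} 𝕜 X (fun _ _ _ T => gammaOp T) (fun _ _ _ T => cc T)
def RDPqo : Prop := Dominates.{w, u, v} 𝕜 X (fun _ _ _ T => omegaOp T) (fun _ _ _ T => cc T)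
def RDPqos : Prop :=
  Dominates.{w, u, v} 𝕜 X (fun _ _ _ T => omegaOp (dualOp T)) (fun _ _ _ T => cc T)

end Properties

end QuantV

end

/-! Every implication comes from an inequality between the controlling quantities of a single
operator, so the choice of `m` plays no role. Seven are short: Right-Cauchy sequences are weakly
Cauchy, and for a sequence with weak* limit `z` one has `dist(z, Y) ≤ ω ≤ ca`. The substantial one
is `uc_le_two_mul_rcc`. If `c < uc(T)`, disjoint blocks of a weakly unconditionally Cauchy (wuC)
series have images `y_j` of norm at least `c`, with norming functionals `g_j`. Rosenthal's
disjointification gives a subfamily with `∑_{i≠k} |g_k(y_i)|` small. The sum `z` of that subseries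
in the bidual satisfies `|z(g_k)| ≈ ‖y_k‖`, while `z(f) ≈ 0` for a weak* cluster point `f` of
`(g_k)`. A point of `Y` cannot separate `g_k` from `f` in the limit, so `z` is almost `c/2` away
from `Y` (`IsWUC.exists_le_distToSpace`). The same argument with weak cluster points shows that
partial sums of a wuC series are Right-Cauchy (`IsWUC.isRightCauchy`). -/

namespace QuantV

/-! ### Rosenthal's disjointification and disjoint blocks -/

section Disjointification

/-- Iterative step of Rosenthal's disjointification lemma. -/
theorem exists_injective_offDiagonal_le_aux (ε : ℝ≥0∞) (hε : ε ≠ ⊤) (n : ℕ) :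
    ∀ b : ℕ → ℕ → ℝ≥0∞, (∀ j, ∑' i, b j i ≤ n * ε) →
      ∃ φ : ℕ → ℕ, Function.Injective φ ∧
        ∀ k, ∑' i, (if i = k then 0 else b (φ k) (φ i)) ≤ ε := by
  induction n with
  | zero =>
    intro b hb
    refine ⟨id, Function.injective_id, fun k => ?_⟩
    refine le_trans (ENNReal.tsum_le_tsum fun i => ?_) ((hb k).trans (by simp))
    split_ifs <;> simp
  | succ n ih =>
    intro b hb
    -- Pairing splits `ℕ` into infinitely many infinite classes, indexed by `p`. Either one class
    -- already works, or each class contains a bad index `q p`; passing to these bad indices lowers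
    -- the row bound by `ε`.
    by_cases h : ∃ p : ℕ, ∀ q : ℕ,
        ∑' i, (if i = q then 0 else b (Nat.pair p q) (Nat.pair p i)) ≤ ε
    · obtain ⟨p, hp⟩ := h
      refine ⟨fun i => Nat.pair p i, fun i j hij => ?_, hp⟩
      exact (Nat.pair_eq_pair.1 hij).2
    · push Not at h
      choose q hq using h
      have hψ : Function.Injective (fun p => Nat.pair p (q p)) :=
        fun i j hij => (Nat.pair_eq_pair.1 hij).1
      obtain ⟨φ, hφ, h⟩ := ih (fun j i => b (Nat.pair j (q j)) (Nat.pair i (q i))) (by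
        intro j
        -- The class of `j` meets the set of bad indices only at `Nat.pair j (q j)`, so the two sums
        -- run over disjoint sets of columns.
        have hsum : ∑' i, b (Nat.pair j (q j)) (Nat.pair i (q i)) +
            ∑' i, (if i = q j then 0 else b (Nat.pair j (q j)) (Nat.pair j i)) ≤
            ∑' i, b (Nat.pair j (q j)) i := by
          set c := b (Nat.pair j (q j))
          have h1 : ∑' i, c (Nat.pair i (q i)) =
              ∑' m : Set.range (fun p => Nat.pair p (q p)), c m := by
            rw [tsum_range (fun m => c m) hψ]
          have h2 : ∑' i, (if i = q j then 0 else c (Nat.pair j i)) ≤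
              ∑' m : ↥(Set.range (fun p => Nat.pair p (q p)))ᶜ, c m := by
            rw [tsum_subtype]
            refine le_trans (ENNReal.tsum_le_tsum fun i => ?_)
              (ENNReal.tsum_comp_le_tsum_of_injective (f := fun i => Nat.pair j i)
                (fun i k hik => (Nat.pair_eq_pair.1 hik).2) _)
            split_ifs with hi
            · simp
            · rw [Set.indicator_of_mem]
              rintro ⟨p, hp⟩
              have := Nat.pair_eq_pair.1 hp
              exact hi (by rw [← this.2, this.1])
          rw [h1]
          refine (add_le_add_right h2 _).trans ?_
          rw [ENNReal.summable.tsum_add_tsum_compl ENNReal.summable]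
        have h3 : ∑' i, b (Nat.pair j (q j)) (Nat.pair i (q i)) + ε ≤ n * ε + ε := by
          refine (add_le_add_right (hq j).le _).trans (hsum.trans ((hb _).trans (le_of_eq ?_)))
          push_cast
          ring
        exact (ENNReal.add_le_add_iff_right hε).1 h3)
      exact ⟨fun i => Nat.pair (φ i) (q (φ i)), hψ.comp hφ, h⟩

/-- Rosenthal's disjointification lemma: an infinite matrix with uniformly bounded row sums has
an infinite submatrix with small off-diagonal row sums. -/
theorem exists_injective_offDiagonal_le {ε : ℝ≥0∞} (hε : ε ≠ ⊤) (hε0 : ε ≠ 0)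
    {R : ℝ≥0∞} (hR : R ≠ ⊤) (b : ℕ → ℕ → ℝ≥0∞) (hb : ∀ j, ∑' i, b j i ≤ R) :
    ∃ φ : ℕ → ℕ, Function.Injective φ ∧
      ∀ k, ∑' i, (if i = k then 0 else b (φ k) (φ i)) ≤ ε := by
  obtain ⟨n, hn⟩ := ENNReal.exists_nat_mul_gt hε0 hR
  exact exists_injective_offDiagonal_le_aux ε hε n b fun j => (hb j).trans hn.le

/-- Each set is chosen beyond the maximum of its predecessors. This turns a failure of the Cauchy
condition into disjoint blocks. -/
theorem exists_pairwise_disjoint_finsets {P : Finset ℕ → Prop}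
    (h : ∀ N : ℕ, ∃ s : Finset ℕ, (∀ i ∈ s, N ≤ i) ∧ P s) :
    ∃ s : ℕ → Finset ℕ, Pairwise (Function.onFun Disjoint s) ∧ ∀ j, P (s j) := by
  choose F hF hP using h
  let N : ℕ → ℕ := fun j => Nat.rec 0 (fun _ n => max n ((F n).sup id + 1)) j
  have hN : ∀ j, N (j + 1) = max (N j) ((F (N j)).sup id + 1) := fun j => rfl
  have hmono : Monotone N := monotone_nat_of_le_succ fun j => by rw [hN]; exact le_max_left _ _
  refine ⟨fun j => F (N j), ?_, fun j => hP _⟩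
  rw [pairwise_disjoint_on]
  intro i j hij
  rw [Finset.disjoint_left]
  intro m hmi hmj
  have h1 : m < N (i + 1) := by
    rw [hN]
    exact lt_max_of_lt_right (Nat.lt_succ_of_le (Finset.le_sup (f := id) hmi))
  exact absurd (hF _ _ hmj) (not_le.2 (h1.trans_le (hmono hij)))

end Disjointification

/-! ### Weakly unconditionally Cauchy series and their bidual sums -/

section WeaklyUnconditionallyCauchy

variable {𝕜 : Type w} [RCLike 𝕜]
variable {E : Type u} [NormedAddCommGroup E] [NormedSpace 𝕜 E]
variable {F : Type v} [NormedAddCommGroup F] [NormedSpace 𝕜 F]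

theorem isWeakStarLimit_iff {x : ℕ → E} {z : StrongDual 𝕜 (StrongDual 𝕜 E)} :
    IsWeakStarLimit 𝕜 x z ↔ ∀ f : StrongDual 𝕜 E, Tendsto (fun n => f (x n)) atTop (𝓝 (z f)) :=
  tendsto_iff_forall_eval_tendsto_topDualPairing

variable (𝕜) in
/-- The series `∑ y_n` is weakly unconditionally Cauchy, with constant `C`. -/
def IsWUC (C : ℝ≥0) (y : ℕ → E) : Prop :=
  ∀ f : StrongDual 𝕜 E, ∑' n, ‖f (y n)‖ₑ ≤ C * ‖f‖ₑ

theorem isWUC_of_forall_norm_le_one {y : ℕ → E}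
    (hy : ∀ f : StrongDual 𝕜 E, ‖f‖ ≤ 1 → ∑' n, ‖f (y n)‖ₑ ≤ 1) : IsWUC 𝕜 1 y := by
  intro f
  by_cases hf : f = 0
  · simp [hf]
  have hn : ‖f‖ ≠ 0 := norm_ne_zero_iff.2 hf
  have h1 : f = (‖f‖ : 𝕜) • ((‖f‖ : 𝕜)⁻¹ • f) := by
    rw [smul_smul, mul_inv_cancel₀ (by exact_mod_cast hn), one_smul]
  have h2 : ∀ n, ‖f (y n)‖ₑ = ‖f‖ₑ * ‖((‖f‖ : 𝕜)⁻¹ • f) (y n)‖ₑ := by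
    intro n
    conv_lhs => rw [h1]
    rw [smul_apply, enorm_smul]
    congr 1
    simp [enorm_eq_nnnorm]
  simp_rw [h2]
  rw [ENNReal.tsum_mul_left, mul_comm]
  gcongr
  exact hy _ (by rw [norm_smul]; simp [hn])

namespace IsWUC

variable {C : ℝ≥0} {y : ℕ → E}

theorem map (hy : IsWUC 𝕜 C y) (T : E →L[𝕜] F) : IsWUC 𝕜 (C * ‖T‖₊) (fun n => T (y n)) := by
  intro f
  refine (hy (f.comp T)).trans ?_
  push_cast
  rw [mul_assoc, mul_comm (‖T‖₊ : ℝ≥0∞)]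
  gcongr
  rw [enorm_eq_nnnorm, enorm_eq_nnnorm]
  exact_mod_cast f.opNNNorm_comp_le T

theorem comp_injective (hy : IsWUC 𝕜 C y) {φ : ℕ → ℕ} (hφ : Function.Injective φ) :
    IsWUC 𝕜 C (fun n => y (φ n)) := fun f =>
  (ENNReal.tsum_comp_le_tsum_of_injective hφ (fun n => ‖f (y n)‖ₑ)).trans (hy f)

theorem blocks (hy : IsWUC 𝕜 C y) {s : ℕ → Finset ℕ}
    (hs : Pairwise (Function.onFun Disjoint s)) : IsWUC 𝕜 C (fun j => ∑ i ∈ s j, y i) := by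
  intro f
  refine le_trans ?_ (hy f)
  calc ∑' j, ‖f (∑ i ∈ s j, y i)‖ₑ ≤ ∑' j, ∑ i ∈ s j, ‖f (y i)‖ₑ := by
        refine ENNReal.tsum_le_tsum fun j => ?_
        rw [map_sum]
        exact enorm_sum_le _ _
    _ ≤ ∑' i, ‖f (y i)‖ₑ := by
        rw [ENNReal.tsum_eq_iSup_sum]
        refine iSup_le fun t => ?_
        rw [← Finset.sum_biUnion fun i _ j _ hij => hs hij]
        exact ENNReal.sum_le_tsum _

theorem tsum_ne_top (hy : IsWUC 𝕜 C y) (f : StrongDual 𝕜 E) : ∑' n, ‖f (y n)‖ₑ ≠ ⊤ :=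
  ne_top_of_le_ne_top (ENNReal.mul_ne_top (by simp) (by simp)) (hy f)

theorem summable (hy : IsWUC 𝕜 C y) (f : StrongDual 𝕜 E) : Summable (fun n => f (y n)) :=
  Summable.of_enorm (hy.tsum_ne_top f)

theorem norm_tsum_le (hy : IsWUC 𝕜 C y) (f : StrongDual 𝕜 E) : ‖∑' n, f (y n)‖ ≤ C * ‖f‖ := by
  have h : ‖∑' n, f (y n)‖ₑ ≤ C * ‖f‖ₑ := enorm_tsum_le_tsum_enorm.trans (hy f)
  rw [enorm_eq_nnnorm, enorm_eq_nnnorm] at h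
  exact_mod_cast h

/-- The sum of a weakly unconditionally Cauchy series in the bidual. -/
noncomputable def sumBidual (hy : IsWUC 𝕜 C y) : StrongDual 𝕜 (StrongDual 𝕜 E) :=
  LinearMap.mkContinuous
    { toFun := fun f => ∑' n, f (y n)
      map_add' := fun f g => by
        simpa using (hy.summable f).tsum_add (hy.summable g)
      map_smul' := fun c f => by
        simpa using tsum_mul_left }
    C hy.norm_tsum_le

theorem sumBidual_apply (hy : IsWUC 𝕜 C y) (f : StrongDual 𝕜 E) :
    hy.sumBidual f = ∑' n, f (y n) := rfl

theorem isWeakStarLimit (hy : IsWUC 𝕜 C y) :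
    IsWeakStarLimit 𝕜 (fun n => ∑ i ∈ Finset.range n, y i) hy.sumBidual := by
  refine isWeakStarLimit_iff.2 fun f => ?_
  simpa [sumBidual_apply] using (hy.summable f).hasSum.tendsto_sum_nat

theorem norm_sum_le (hy : IsWUC 𝕜 C y) (s : Finset ℕ) : ‖∑ i ∈ s, y i‖ ≤ C := by
  refine NormedSpace.norm_le_dual_bound 𝕜 _ C.2 fun f => ?_
  have h : ‖f (∑ i ∈ s, y i)‖ₑ ≤ C * ‖f‖ₑ := by
    rw [map_sum]
    exact ((enorm_sum_le _ _).trans (ENNReal.sum_le_tsum s)).trans (hy f)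
  rw [enorm_eq_nnnorm, enorm_eq_nnnorm] at h
  exact_mod_cast h

/-- Almost biorthogonal subsystems of a weakly unconditionally Cauchy series. -/
theorem exists_injective_offDiagonal_le (hy : IsWUC 𝕜 C y) {g : ℕ → StrongDual 𝕜 E} {R : ℝ≥0}
    (hg : ∀ j, ‖g j‖ₑ ≤ R) {ε : ℝ≥0} (hε : 0 < ε) :
    ∃ φ : ℕ → ℕ, Function.Injective φ ∧
      ∀ k, ∑' i, (if i = k then 0 else ‖g (φ k) (y (φ i))‖ₑ) ≤ ε :=
  QuantV.exists_injective_offDiagonal_le (R := C * R) (by simp) (by simpa using hε.ne')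
    (ENNReal.mul_ne_top (by simp) (by simp)) (fun j i => ‖g j (y i)‖ₑ)
    fun j => (hy (g j)).trans (by gcongr; exact hg j)

theorem norm_sumBidual_sub_le (hy : IsWUC 𝕜 C y) {f : StrongDual 𝕜 E} {k : ℕ} {ε : ℝ≥0}
    (h : ∑' i, (if i = k then 0 else ‖f (y i)‖ₑ) ≤ ε) : ‖hy.sumBidual f - f (y k)‖ ≤ ε := by
  rw [sumBidual_apply, (hy.summable f).tsum_eq_add_tsum_ite k, add_sub_cancel_left]
  have h1 : ‖∑' i, (if i = k then 0 else f (y i))‖ₑ ≤ ε := by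
    refine enorm_tsum_le_tsum_enorm.trans (le_trans (ENNReal.tsum_le_tsum fun i => ?_) h)
    split_ifs <;> simp
  rw [enorm_eq_nnnorm] at h1
  exact_mod_cast h1

/-- For `k ≥ n` the first `n` terms are all off-diagonal for `g k`, so their sum is at most `ε`;
this survives the pointwise limit, and then `n` is arbitrary. -/
theorem norm_sumBidual_le_of_tendsto (hy : IsWUC 𝕜 C y) {g : ℕ → StrongDual 𝕜 E} {ε : ℝ≥0}
    (h : ∀ k, ∑' i, (if i = k then 0 else ‖g k (y i)‖ₑ) ≤ ε)
    {l : Filter ℕ} [l.NeBot] (hl : l ≤ atTop) {f : StrongDual 𝕜 E}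
    (hf : ∀ x, Tendsto (fun k => g k x) l (𝓝 (f x))) : ‖hy.sumBidual f‖ ≤ ε := by
  have h1 : ∑' i, ‖f (y i)‖ₑ ≤ ε := by
    rw [ENNReal.tsum_eq_iSup_nat]
    refine iSup_le fun n => ?_
    refine le_of_tendsto (tendsto_finsetSum (Finset.range n) fun i _ => (hf (y i)).enorm) ?_
    filter_upwards [hl (eventually_ge_atTop n)] with k hk
    refine le_trans (Finset.sum_le_sum fun i hi => ?_)
      ((ENNReal.sum_le_tsum (Finset.range n)).trans (h k))
    rw [if_neg (by have := Finset.mem_range.1 hi; omega)]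
  have h2 : ‖hy.sumBidual f‖ₑ ≤ ε := (enorm_tsum_le_tsum_enorm).trans h1
  rw [enorm_eq_nnnorm] at h2
  exact_mod_cast h2

end IsWUC

end WeaklyUnconditionallyCauchy

/-! ### Weak and weak* cluster points; Right-Cauchy partial sums -/

section WeakCompactness

variable {𝕜 : Type w} [RCLike 𝕜]
variable {E : Type u} [NormedAddCommGroup E] [NormedSpace 𝕜 E]

/-- A limit along a nonprincipal ultrafilter suffices, so no Eberlein–Šmulian subsequence is needed.
-/
theorem IsWeaklyCompact.exists_tendsto_hyperfilter {K : Set E} (hK : IsWeaklyCompact 𝕜 K)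
    {x : ℕ → E} (hx : ∀ n, x n ∈ K) :
    ∃ a ∈ K, ∀ f : StrongDual 𝕜 E,
      Tendsto (fun n => f (x n)) (hyperfilter ℕ) (𝓝 (f a)) := by
  obtain ⟨_, ⟨a, ha, rfl⟩, h⟩ := hK.ultrafilter_le_nhds
    ((hyperfilter ℕ).map fun n => toWeakSpace 𝕜 E (x n))
    (le_principal_iff.2 <| Ultrafilter.mem_map.2 <| Filter.univ_mem' fun n => ⟨x n, hx n, rfl⟩)
  refine ⟨a, ha, fun f => ?_⟩
  have hf : Continuous fun z : WeakSpace 𝕜 E => f ((toWeakSpace 𝕜 E).symm z) :=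
    WeakBilin.eval_continuous (topDualPairing 𝕜 E).flip f
  exact (hf.tendsto _).comp h

theorem exists_dual_tendsto_hyperfilter {g : ℕ → StrongDual 𝕜 E} {R : ℝ}
    (hg : ∀ n, ‖g n‖ ≤ R) :
    ∃ f : StrongDual 𝕜 E, ∀ x, Tendsto (fun n => g n x) (hyperfilter ℕ) (𝓝 (f x)) := by
  obtain ⟨f, -, h⟩ := (WeakDual.isCompact_closedBall (0 : StrongDual 𝕜 E) R).ultrafilter_le_nhds
    ((hyperfilter ℕ).map fun n => StrongDual.toWeakDual (g n))
    (le_principal_iff.2 <| Ultrafilter.mem_map.2 <| Filter.univ_mem' fun n => by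
      simpa using hg n)
  exact ⟨WeakDual.toStrongDual f, tendsto_iff_forall_eval_tendsto_topDualPairing.1 h⟩

theorem IsWeaklyCompact.exists_norm_le [CompleteSpace E] {K : Set (StrongDual 𝕜 E)}
    (hK : IsWeaklyCompact 𝕜 K) : ∃ R : ℝ≥0, ∀ f ∈ K, ‖f‖ₑ ≤ R := by
  obtain ⟨R, hR⟩ := banach_steinhaus (g := fun f : K => (f : StrongDual 𝕜 E)) (by
    intro x
    have hx : Continuous fun z : WeakSpace 𝕜 (StrongDual 𝕜 E) =>
        (toWeakSpace 𝕜 (StrongDual 𝕜 E)).symm z x :=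
      WeakBilin.eval_continuous (topDualPairing 𝕜 (StrongDual 𝕜 E)).flip
        (NormedSpace.inclusionInDoubleDual 𝕜 E x)
    obtain ⟨B, hB⟩ := (hK.image hx).isBounded.exists_norm_le
    exact ⟨B, fun f => hB _ ⟨_, ⟨f, f.2, rfl⟩, rfl⟩⟩)
  refine ⟨R.toNNReal, fun f hf => ?_⟩
  rw [enorm_eq_nnnorm, ENNReal.coe_le_coe, ← NNReal.coe_le_coe]
  exact (hR ⟨f, hf⟩).trans (Real.le_coe_toNNReal R)

theorem IsRightCauchy.isWeaklyCauchy {x : ℕ → E} (hx : IsRightCauchy 𝕜 x) :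
    IsWeaklyCauchy 𝕜 x := by
  intro f
  have h := hx {f} (by simp [IsWeaklyCompact])
  rw [Metric.cauchySeq_iff]
  intro ε hε
  obtain ⟨N, hN⟩ := Metric.uniformCauchySeqOn_iff.1 h ε hε
  exact ⟨N, fun m hm n hn => hN m hm n hn f rfl⟩

/-- The partial sums of a weakly unconditionally Cauchy series are Right-Cauchy. -/
theorem IsWUC.isRightCauchy [CompleteSpace E] {C : ℝ≥0} {y : ℕ → E} (hy : IsWUC 𝕜 C y) :
    IsRightCauchy 𝕜 (fun n => ∑ i ∈ Finset.range n, y i) := by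
  intro K hK
  rw [Metric.uniformCauchySeqOn_iff]
  by_contra! hcon
  obtain ⟨ε, hε, hcon⟩ := hcon
  obtain ⟨s, hs, hP⟩ := exists_pairwise_disjoint_finsets
    (P := fun s => ∃ f ∈ K, ε ≤ ‖f (∑ i ∈ s, y i)‖) (by
      intro N
      obtain ⟨k, hk, l, hl, f, hf, h⟩ := hcon N
      wlog hkl : l ≤ k generalizing k l
      · exact this l hl k hk (by rwa [dist_comm]) (by omega)
      refine ⟨Finset.Ico l k, fun i hi => hl.le.trans (Finset.mem_Ico.1 hi).1, f, hf, ?_⟩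
      rwa [Finset.sum_Ico_eq_sub _ hkl, map_sub, ← dist_eq_norm])
  choose g hgK hg using hP
  obtain ⟨R, hR⟩ := hK.exists_norm_le
  obtain ⟨δ, hδ0, hδ⟩ : ∃ δ : ℝ≥0, 0 < δ ∧ 4 * (δ : ℝ) = ε :=
    ⟨(ε / 4).toNNReal, Real.toNNReal_pos.2 (by positivity), by
      rw [Real.coe_toNNReal _ (by positivity)]
      ring⟩
  obtain ⟨φ, hφ, hoff⟩ := (hy.blocks hs).exists_injective_offDiagonal_le
    (fun j => hR _ (hgK j)) hδ0
  have hw := (hy.blocks hs).comp_injective hφ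
  obtain ⟨f, -, hf⟩ := hK.exists_tendsto_hyperfilter fun k => hgK (φ k)
  have h1 : ‖hw.sumBidual f‖ ≤ δ := hw.norm_sumBidual_le_of_tendsto hoff
    Nat.hyperfilter_le_atTop fun x => hf (NormedSpace.inclusionInDoubleDual 𝕜 E x)
  -- Weak convergence in the dual is essential here: it is tested against the bidual element
  -- `hw.sumBidual`. With `ε = 4δ` the bounds `ε - δ` and `δ` contradict each other.
  have h2 : ε - δ ≤ ‖hw.sumBidual f‖ := by
    refine ge_of_tendsto (hf hw.sumBidual).norm (Eventually.of_forall fun k => ?_)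
    have h3 := hw.norm_sumBidual_sub_le (hoff k)
    have h4 := norm_sub_norm_le (g (φ k) (∑ i ∈ s (φ k), y i)) (hw.sumBidual (g (φ k)))
    rw [norm_sub_rev] at h4
    linarith [hg (φ k)]
  have : (0 : ℝ) < δ := hδ0
  linarith

/-- If the terms `y_k` of a weakly unconditionally Cauchy series have norm at least `c`, some
subseries has its bidual sum almost at distance `c / 2` from the space. -/
theorem IsWUC.exists_le_distToSpace {C : ℝ≥0} {y : ℕ → E} (hy : IsWUC 𝕜 C y) {c : ℝ≥0}
    (hc : ∀ j, (c : ℝ) ≤ ‖y j‖) {δ : ℝ≥0} (hδ : 0 < δ) :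
    ∃ φ : ℕ → ℕ, Function.Injective φ ∧ ∀ z : StrongDual 𝕜 (StrongDual 𝕜 E),
      IsWeakStarLimit 𝕜 (fun n => ∑ i ∈ Finset.range n, y (φ i)) z →
        (c : ℝ≥0∞) ≤ 2 * distToSpace 𝕜 z + 2 * δ := by
  choose g hg1 hg using fun j => exists_dual_vector'' 𝕜 (y j)
  obtain ⟨φ, hφ, hoff⟩ := hy.exists_injective_offDiagonal_le (R := 1)
    (fun j => by
      rw [enorm_eq_nnnorm]
      exact_mod_cast hg1 j) hδ
  refine ⟨φ, hφ, fun z hz => ?_⟩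
  have hw := hy.comp_injective hφ
  obtain rfl : z = hw.sumBidual := by
    ext f
    exact tendsto_nhds_unique (isWeakStarLimit_iff.1 hz f)
      (isWeakStarLimit_iff.1 hw.isWeakStarLimit f)
  obtain ⟨f, hf⟩ := exists_dual_tendsto_hyperfilter fun k => hg1 (φ k)
  have hfn : ‖f‖ ≤ 1 := by
    refine ContinuousLinearMap.opNorm_le_bound _ zero_le_one fun x => ?_
    exact le_of_tendsto (hf x).norm (Eventually.of_forall fun k =>
      (g (φ k)).le_of_opNorm_le (hg1 _) x)
  have h1 : ‖hw.sumBidual f‖ ≤ δ := hw.norm_sumBidual_le_of_tendsto hoff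
    Nat.hyperfilter_le_atTop hf
  have key : ∀ x : E, (c : ℝ) ≤
      2 * ‖hw.sumBidual - NormedSpace.inclusionInDoubleDual 𝕜 E x‖ + 2 * δ := by
    intro x
    set D := hw.sumBidual - NormedSpace.inclusionInDoubleDual 𝕜 E x
    have hlim : Tendsto (fun k => 2 * ‖D‖ + 2 * δ + ‖g (φ k) x - f x‖) (hyperfilter ℕ)
        (𝓝 (2 * ‖D‖ + 2 * δ + ‖f x - f x‖)) :=
      tendsto_const_nhds.add ((hf x).sub tendsto_const_nhds).norm
    rw [sub_self, norm_zero, add_zero] at hlim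
    refine ge_of_tendsto hlim (Eventually.of_forall fun k => ?_)
    have h3 := hw.norm_sumBidual_sub_le (hoff k)
    -- The factor 2 arises because `g (φ k)` and `f` both lie in the dual unit ball.
    have h4 : ‖D (g (φ k) - f)‖ ≤ 2 * ‖D‖ := by
      refine (D.le_opNorm _).trans ?_
      rw [mul_comm]
      gcongr
      linarith [norm_sub_le (g (φ k)) f, hg1 (φ k)]
    have h5 : g (φ k) (y (φ k)) = D (g (φ k) - f) + (g (φ k) x - f x)
        + hw.sumBidual f - (hw.sumBidual (g (φ k)) - g (φ k) (y (φ k))) := by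
      simp only [D, map_sub, sub_apply, NormedSpace.dual_def]
      ring
    have h6 : ‖g (φ k) (y (φ k))‖ = ‖y (φ k)‖ := by rw [hg]; simp
    have h7 := norm_sub_le (D (g (φ k) - f) + (g (φ k) x - f x) + hw.sumBidual f)
      (hw.sumBidual (g (φ k)) - g (φ k) (y (φ k)))
    have h8 := norm_add₃_le (a := D (g (φ k) - f)) (b := g (φ k) x - f x) (c := hw.sumBidual f)
    rw [← h5, h6] at h7
    linarith [hc (φ k)]
  unfold distToSpace Metric.infEDist
  rw [ENNReal.mul_iInf_of_ne two_ne_zero ENNReal.ofNat_ne_top, ENNReal.iInf_add]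
  refine le_iInf fun v => ?_
  rw [ENNReal.mul_iInf_of_ne two_ne_zero ENNReal.ofNat_ne_top, ENNReal.iInf_add]
  refine le_iInf fun hv => ?_
  obtain ⟨x, rfl⟩ := hv
  rw [edist_eq_enorm_sub, enorm_eq_nnnorm]
  exact_mod_cast key x

end WeakCompactness

/-! ### Inequalities between the quantities, and the diagram -/

section Comparison

variable {𝕜 : Type w} [RCLike 𝕜]
variable {X : Type u} [NormedAddCommGroup X] [NormedSpace 𝕜 X]
variable {Y : Type v} [NormedAddCommGroup Y] [NormedSpace 𝕜 Y]

/-- Nearly optimal approximants of `y n` in `K` cluster weakly at some `a ∈ K`; the uniform bound on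
the differences passes to `z - a`. -/
theorem distToSpace_le_omegaSet_range {y : ℕ → Y} {z : StrongDual 𝕜 (StrongDual 𝕜 Y)}
    (hz : IsWeakStarLimit 𝕜 y z) : distToSpace 𝕜 z ≤ omegaSet 𝕜 (Set.range y) := by
  refine le_sInf ?_
  rintro _ ⟨K, -, hK, rfl⟩
  refine ENNReal.le_of_forall_pos_le_add fun δ hδ hfin => ?_
  set r := hausExcess (Set.range y) K + δ
  have hrt : r ≠ ⊤ := ENNReal.add_ne_top.2 ⟨hfin.ne, ENNReal.coe_ne_top⟩
  have hex : ∀ n, ∃ a ∈ K, edist (y n) a < r := fun n => by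
    refine Metric.infEDist_lt_iff.1 (lt_of_le_of_lt ?_
      (ENNReal.lt_add_right hfin.ne (by simpa using hδ.ne')))
    exact le_iSup₂ (f := fun a (_ : a ∈ Set.range y) => Metric.infEDist a K) (y n) ⟨n, rfl⟩
  choose k hkK hk using hex
  obtain ⟨a, -, ha⟩ := hK.exists_tendsto_hyperfilter hkK
  refine (Metric.infEDist_le_edist_of_mem (Set.mem_range_self a)).trans ?_
  rw [edist_dist, dist_eq_norm]
  refine ENNReal.ofReal_le_of_le_toReal ?_
  refine ContinuousLinearMap.opNorm_le_bound _ ENNReal.toReal_nonneg fun f => ?_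
  have hlim := (((isWeakStarLimit_iff.1 hz f).mono_left Nat.hyperfilter_le_atTop).sub
    (ha f)).norm
  rw [sub_apply, NormedSpace.dual_def]
  refine le_of_tendsto hlim (Eventually.of_forall fun n => ?_)
  rw [← map_sub]
  refine (f.le_opNorm _).trans ?_
  rw [mul_comm]
  gcongr
  rw [← dist_eq_norm, dist_edist]
  exact ENNReal.toReal_mono hrt (hk n).le

/-- The finite set of terms up to index `n` serves as the weakly compact set. -/
theorem omegaSet_range_le_ca (y : ℕ → Y) : omegaSet 𝕜 (Set.range y) ≤ ca y := by
  refine le_iInf fun n => ?_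
  have hmem : y n ∈ y '' Set.Iic n := Set.mem_image_of_mem y (Set.mem_Iic.2 le_rfl)
  refine le_trans (b := hausExcess (Set.range y) (y '' Set.Iic n))
    (sInf_le ⟨_, ⟨_, hmem⟩, ?_, rfl⟩) ?_
  · exact (((Set.finite_Iic n).image y).image _).isCompact
  · refine iSup₂_le ?_
    rintro _ ⟨k, rfl⟩
    rcases le_total k n with h | h
    · rw [Metric.infEDist_zero_of_mem (Set.mem_image_of_mem y (Set.mem_Iic.2 h))]
      exact zero_le
    · exact (Metric.infEDist_le_edist_of_mem hmem).trans
        (le_iSup₂_of_le k h (le_iSup₂_of_le n le_rfl le_rfl))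

theorem ccRho_le_cc (T : X →L[𝕜] Y) : ccRho T ≤ cc T :=
  sSup_le_sSup fun _ ⟨x, h1, h2, h3⟩ => ⟨x, h1, h2.isWeaklyCauchy, h3⟩

theorem rccOmega_le_wccOmega (T : X →L[𝕜] Y) : rccOmega T ≤ wccOmega T :=
  sSup_le_sSup fun _ ⟨x, h1, h2, h3⟩ => ⟨x, h1, h2.isWeaklyCauchy, h3⟩

theorem rcc_le_wcc (T : X →L[𝕜] Y) : rcc T ≤ wcc T :=
  sSup_le_sSup fun _ ⟨x, z, h1, h2, h3⟩ => ⟨x, z, h1, h2.isWeaklyCauchy, h3⟩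

theorem rccOmega_le_ccRho (T : X →L[𝕜] Y) : rccOmega T ≤ ccRho T := by
  refine sSup_le ?_
  rintro _ ⟨x, h1, h2, rfl⟩
  exact (omegaSet_range_le_ca _).trans (le_sSup ⟨x, h1, h2, rfl⟩)

theorem wccOmega_le_cc (T : X →L[𝕜] Y) : wccOmega T ≤ cc T := by
  refine sSup_le ?_
  rintro _ ⟨x, h1, h2, rfl⟩
  exact (omegaSet_range_le_ca _).trans (le_sSup ⟨x, h1, h2, rfl⟩)

theorem rcc_le_rccOmega (T : X →L[𝕜] Y) : rcc T ≤ rccOmega T := by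
  refine sSup_le ?_
  rintro _ ⟨x, z, h1, h2, hz, rfl⟩
  exact (distToSpace_le_omegaSet_range hz).trans (le_sSup ⟨x, h1, h2, rfl⟩)

theorem wcc_le_wccOmega (T : X →L[𝕜] Y) : wcc T ≤ wccOmega T := by
  refine sSup_le ?_
  rintro _ ⟨x, z, h1, h2, hz, rfl⟩
  exact (distToSpace_le_omegaSet_range hz).trans (le_sSup ⟨x, h1, h2, rfl⟩)

theorem uc_le_two_mul_rcc [CompleteSpace X] (T : X →L[𝕜] Y) : uc T ≤ 2 * rcc T := by
  refine sSup_le ?_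
  rintro _ ⟨x, hx, rfl⟩
  have hwuc := isWUC_of_forall_norm_le_one hx
  refine ENNReal.le_of_forall_nnreal_lt fun c hc => ?_
  obtain ⟨s, hs, hP⟩ := exists_pairwise_disjoint_finsets
    (P := fun s => (c : ℝ) ≤ ‖T (∑ i ∈ s, x i)‖) (by
      intro N
      have h := hc.trans_le (iInf_le _ N)
      simp only [lt_iSup_iff] at h
      obtain ⟨k, hk, l, hl, h⟩ := h
      wlog hkl : l ≤ k generalizing k l
      · exact this l hl k hk (by rwa [edist_comm]) (by omega)
      -- The `n`-th partial sum in `uc` includes the term of index `n`, hence the shift by one.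
      refine ⟨Finset.Ico (l + 1) (k + 1),
        fun i hi => by have := (Finset.mem_Ico.1 hi).1; omega, ?_⟩
      rw [map_sum, Finset.sum_Ico_eq_sub _ (by omega : l + 1 ≤ k + 1)]
      rw [edist_eq_enorm_sub, enorm_eq_nnnorm] at h
      exact_mod_cast h.le)
  have hb := hwuc.blocks hs
  refine ENNReal.le_of_forall_pos_le_add fun δ hδ _ => ?_
  obtain ⟨φ, hφ, h⟩ := (hb.map T).exists_le_distToSpace hP (δ := δ / 2) (by positivity)
  have hw := hb.comp_injective hφ
  have hz := (hw.map T).isWeakStarLimit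
  refine (h _ hz).trans ?_
  have h2 : (2 : ℝ≥0∞) * ((δ / 2 : ℝ≥0) : ℝ≥0∞) = δ := by
    rw [← ENNReal.coe_ofNat, ← ENNReal.coe_mul, mul_div_cancel₀ _ two_ne_zero]
  rw [h2]
  gcongr
  -- The partial sums of the selected blocks in `X` are the witness; the wuC constant 1 keeps them
  -- in the unit ball.
  refine le_sSup ⟨_, _, fun n => ?_, hw.isRightCauchy, ?_, rfl⟩
  · simpa using hw.norm_sum_le (Finset.range n)
  · simpa only [map_sum] using hz

variable (X) in
theorem Dominates.of_le_mul
    {p q r : ∀ (Y : Type v) [NormedAddCommGroup Y] [NormedSpace 𝕜 Y], (X →L[𝕜] Y) → ℝ≥0∞}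
    (D : ℝ≥0) (hD : 0 < D)
    (hqr : ∀ (Y : Type v) [NormedAddCommGroup Y] [NormedSpace 𝕜 Y] (T : X →L[𝕜] Y),
      q Y T ≤ D * r Y T)
    (h : Dominates.{w, u, v} 𝕜 X p q) : Dominates.{w, u, v} 𝕜 X p r := by
  obtain ⟨C, hC, h⟩ := h
  refine ⟨C * D, mul_pos hC hD, fun Y _ _ _ T => (h Y T).trans ?_⟩
  rw [ENNReal.coe_mul, mul_assoc]
  gcongr
  exact hqr Y T

variable (X) in
theorem Dominates.of_le
    {p q r : ∀ (Y : Type v) [NormedAddCommGroup Y] [NormedSpace 𝕜 Y], (X →L[𝕜] Y) → ℝ≥0∞}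
    (hqr : ∀ (Y : Type v) [NormedAddCommGroup Y] [NormedSpace 𝕜 Y] (T : X →L[𝕜] Y),
      q Y T ≤ r Y T)
    (h : Dominates.{w, u, v} 𝕜 X p q) : Dominates.{w, u, v} 𝕜 X p r :=
  h.of_le_mul X 1 one_pos fun Y _ _ T => by simpa using hqr Y T

theorem Dominates.diagram [CompleteSpace X]
    (m : ∀ (Y : Type v) [NormedAddCommGroup Y] [NormedSpace 𝕜 Y], (X →L[𝕜] Y) → ℝ≥0∞) :
    (Dominates.{w, u, v} 𝕜 X m (fun _ _ _ T => uc T) →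
      Dominates.{w, u, v} 𝕜 X m (fun _ _ _ T => rcc T)) ∧
    (Dominates.{w, u, v} 𝕜 X m (fun _ _ _ T => rcc T) →
      Dominates.{w, u, v} 𝕜 X m (fun _ _ _ T => rccOmega T)) ∧
    (Dominates.{w, u, v} 𝕜 X m (fun _ _ _ T => rccOmega T) →
      Dominates.{w, u, v} 𝕜 X m (fun _ _ _ T => ccRho T)) ∧
    (Dominates.{w, u, v} 𝕜 X m (fun _ _ _ T => rcc T) →
      Dominates.{w, u, v} 𝕜 X m (fun _ _ _ T => wcc T)) ∧
    (Dominates.{w, u, v} 𝕜 X m (fun _ _ _ T => rccOmega T) →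
      Dominates.{w, u, v} 𝕜 X m (fun _ _ _ T => wccOmega T)) ∧
    (Dominates.{w, u, v} 𝕜 X m (fun _ _ _ T => ccRho T) →
      Dominates.{w, u, v} 𝕜 X m (fun _ _ _ T => cc T)) ∧
    (Dominates.{w, u, v} 𝕜 X m (fun _ _ _ T => wcc T) →
      Dominates.{w, u, v} 𝕜 X m (fun _ _ _ T => wccOmega T)) ∧
    (Dominates.{w, u, v} 𝕜 X m (fun _ _ _ T => wccOmega T) →
      Dominates.{w, u, v} 𝕜 X m (fun _ _ _ T => cc T)) :=
  ⟨Dominates.of_le_mul X 2 two_pos fun _ _ _ T => by simpa using uc_le_two_mul_rcc T,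
    Dominates.of_le X fun _ _ _ T => rcc_le_rccOmega T,
    Dominates.of_le X fun _ _ _ T => rccOmega_le_ccRho T,
    Dominates.of_le X fun _ _ _ T => rcc_le_wcc T,
    Dominates.of_le X fun _ _ _ T => rccOmega_le_wccOmega T,
    Dominates.of_le X fun _ _ _ T => ccRho_le_cc T,
    Dominates.of_le X fun _ _ _ T => wcc_le_wccOmega T,
    Dominates.of_le X fun _ _ _ T => wccOmega_le_cc T⟩

end Comparison

end QuantV

theorem theorem5p2 (𝕜 : Type w) [RCLike 𝕜]
    (X : Type u) [NormedAddCommGroup X] [NormedSpace 𝕜 X] [CompleteSpace X] :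
    ((QuantV.Vq.{w, u, v} 𝕜 X → QuantV.RDq.{w, u, v} 𝕜 X) ∧
      (QuantV.RDq.{w, u, v} 𝕜 X → QuantV.RDqO.{w, u, v} 𝕜 X) ∧
      (QuantV.RDqO.{w, u, v} 𝕜 X → QuantV.SRq.{w, u, v} 𝕜 X) ∧
      (QuantV.RDq.{w, u, v} 𝕜 X → QuantV.Dq.{w, u, v} 𝕜 X) ∧
      (QuantV.RDqO.{w, u, v} 𝕜 X → QuantV.DqO.{w, u, v} 𝕜 X) ∧
      (QuantV.SRq.{w, u, v} 𝕜 X → QuantV.RDPq.{w, u, v} 𝕜 X) ∧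
      (QuantV.Dq.{w, u, v} 𝕜 X → QuantV.DqO.{w, u, v} 𝕜 X) ∧
      (QuantV.DqO.{w, u, v} 𝕜 X → QuantV.RDPq.{w, u, v} 𝕜 X)) ∧
    ((QuantV.Vqo.{w, u, v} 𝕜 X → QuantV.RDqo.{w, u, v} 𝕜 X) ∧
      (QuantV.RDqo.{w, u, v} 𝕜 X → QuantV.RDqoO.{w, u, v} 𝕜 X) ∧
      (QuantV.RDqoO.{w, u, v} 𝕜 X → QuantV.SRqo.{w, u, v} 𝕜 X) ∧
      (QuantV.RDqo.{w, u, v} 𝕜 X → QuantV.Dqo.{w, u, v} 𝕜 X) ∧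
      (QuantV.RDqoO.{w, u, v} 𝕜 X → QuantV.DqoO.{w, u, v} 𝕜 X) ∧
      (QuantV.SRqo.{w, u, v} 𝕜 X → QuantV.RDPqo.{w, u, v} 𝕜 X) ∧
      (QuantV.Dqo.{w, u, v} 𝕜 X → QuantV.DqoO.{w, u, v} 𝕜 X) ∧
      (QuantV.DqoO.{w, u, v} 𝕜 X → QuantV.RDPqo.{w, u, v} 𝕜 X)) ∧
    ((QuantV.Vqos.{w, u, v} 𝕜 X → QuantV.RDqos.{w, u, v} 𝕜 X) ∧
      (QuantV.RDqos.{w, u, v} 𝕜 X → QuantV.RDqosO.{w, u, v} 𝕜 X) ∧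
      (QuantV.RDqosO.{w, u, v} 𝕜 X → QuantV.SRqos.{w, u, v} 𝕜 X) ∧
      (QuantV.RDqos.{w, u, v} 𝕜 X → QuantV.Dqos.{w, u, v} 𝕜 X) ∧
      (QuantV.RDqosO.{w, u, v} 𝕜 X → QuantV.DqosO.{w, u, v} 𝕜 X) ∧
      (QuantV.SRqos.{w, u, v} 𝕜 X → QuantV.RDPqos.{w, u, v} 𝕜 X) ∧
      (QuantV.Dqos.{w, u, v} 𝕜 X → QuantV.DqosO.{w, u, v} 𝕜 X) ∧
      (QuantV.DqosO.{w, u, v} 𝕜 X → QuantV.RDPqos.{w, u, v} 𝕜 X)) := by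
  refine ⟨?_, ?_, ?_⟩
  · exact QuantV.Dominates.diagram.{w, u, v} (𝕜 := 𝕜) (X := X)
      (fun Y _ _ (T : X →L[𝕜] Y) => QuantV.gammaOp T)
  · exact QuantV.Dominates.diagram.{w, u, v} (𝕜 := 𝕜) (X := X)
      (fun Y _ _ (T : X →L[𝕜] Y) => QuantV.omegaOp T)
  · exact QuantV.Dominates.diagram.{w, u, v} (𝕜 := 𝕜) (X := X)
      (fun Y _ _ (T : X →L[𝕜] Y) => QuantV.omegaOp (QuantV.dualOp T))
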